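/- Let $n,q\in\mathbb N$. A set $\Omega$ in a Euclidean space is called nearly convex if there is a convex set $C$ with $C\subset\Omega\subset\overline C$; a function $\phi\colon\mathbb R^n\to[-\infty,\infty]$ is nearly convex if its epigraph $\{(x,\lambda)\in\mathbb R^n\times\mathbb R\mid \phi(x)\le\lambda\}$ is nearly convex, and proper if $\operatorname{dom}\phi=\{x\mid\phi(x)<\infty\}\ne\emptyset$ and $\phi(x)>-\infty$ for all $x$; a set-valued mapping $G\colon\mathbb R^n\rightrightarrows\mathbb R^q$ is nearly convex if its graph $\{(x,y)\mid y\in G(x)\}$ is nearly convex. Write $\operatorname{dom}G=\{x\mid G(x)\neq\emptyset\}$, $G(\Omega)=\bigcup_{x\in\Omega}G(x)$, and let $\operatorname{ri}\Omega$ be the relative interior of $\Omega$, i.e. its interior relative to its affine hull. **Theorem.** Let $\phi\colon\mathbb R^n\to[-\infty,\infty]$ be a proper nearly convex function, let $\Theta\subset\mathbb R^n$ be a nearly convex set, and let $G\colon\mathbb R^n\rightrightarrows\mathbb R^q$ be a nearly convex set-valued mapping. Suppose that $$\operatorname{ri}(\operatorname{dom}\phi)\cap\operatorname{ri}(\operatorname{dom}G)\cap\operatorname{ri}\Theta\neq\emptyset\quad\text{and}\quad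 0\in\operatorname{ri}\big(G(\Theta\cap\operatorname{dom}\phi)\big).$$ Then Lagrange–Fenchel strong duality holds, that is, $$\inf\{\phi(x)\mid x\in\Theta,\ 0\in G(x)\}=\sup_{u^*\in\mathbb R^n,\ y^*\in\mathbb R^q}\Big(-\phi^*(u^*)+\inf_{x\in\Theta}\big[\langle u^*,x\rangle+v_G(x,y^*)\big]\Big)$$ as elements of $[-\infty,\infty]$, where $\phi^*(u^*)=\sup_{x\in\mathbb R^n}\big(\langle u^*,x\rangle-\phi(x)\big)$ is the Fenchel conjugate of $\phi$ and $v_G(x,y^*)=\inf\{\langle -y^*,y\rangle\mid y\in G(x)\}$, with $\inf\emptyset=+\infty$. -/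

import Mathlib

namespace NearConvexDuality

/-- A set is nearly convex if it lies between a convex set and the closure of that convex set. -/
def NearlyConvex {E : Type*} [AddCommGroup E] [Module ℝ E] [TopologicalSpace E]
    (Ω : Set E) : Prop :=
  ∃ C : Set E, Convex ℝ C ∧ C ⊆ Ω ∧ Ω ⊆ closure C

/-- The effective domain of an extended-real-valued function. -/
def effDom {E : Type*} (f : E → EReal) : Set E :=
  {x | f x < ⊤}

/-- The epigraph of an extended-real-valued function. -/
def epi {E : Type*} (f : E → EReal) : Set (E × ℝ) :=
  {p | f p.1 ≤ (p.2 : EReal)}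

/-- A proper function: nonempty effective domain, and the value `-∞` is never taken. -/
def ProperFun {E : Type*} (f : E → EReal) : Prop :=
  (effDom f).Nonempty ∧ ∀ x, ⊥ < f x

/-- A function is nearly convex if its epigraph is a nearly convex set. -/
def NearlyConvexFun {E : Type*} [AddCommGroup E] [Module ℝ E] [TopologicalSpace E]
    (f : E → EReal) : Prop :=
  NearlyConvex (epi f)

/-- The domain of a set-valued mapping. -/
def svDom {E F : Type*} (G : E → Set F) : Set E :=
  {x | (G x).Nonempty}

/-- The graph of a set-valued mapping. -/
def svGraph {E F : Type*} (G : E → Set F) : Set (E × F) :=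
  {p | p.2 ∈ G p.1}

/-- The image of a set under a set-valued mapping. -/
def svImage {E F : Type*} (G : E → Set F) (Ω : Set E) : Set F :=
  ⋃ x ∈ Ω, G x

/-- A set-valued mapping is nearly convex if its graph is a nearly convex set. -/
def NearlyConvexMap {E F : Type*} [AddCommGroup E] [Module ℝ E] [TopologicalSpace E]
    [AddCommGroup F] [Module ℝ F] [TopologicalSpace F] (G : E → Set F) : Prop :=
  NearlyConvex (svGraph G)

/-- The Fenchel conjugate `f*(u) = sup {⟨u, x⟩ - f x | x}`. -/
noncomputable def fenchelConj {E : Type*} [NormedAddCommGroup E] [InnerProductSpace ℝ E]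
    (f : E → EReal) (u : E) : EReal :=
  ⨆ x : E, ((inner ℝ u x : ℝ) : EReal) - f x

/-- `v_G(x, y*) = inf {⟨-y*, y⟩ | y ∈ G x}`, which is `+∞` when `G x` is empty. -/
noncomputable def vG {E F : Type*} [NormedAddCommGroup F] [InnerProductSpace ℝ F]
    (G : E → Set F) (x : E) (ystar : F) : EReal :=
  ⨅ y ∈ G x, ((inner ℝ (-ystar) y : ℝ) : EReal)

/-- The optimal value of the problem: minimize `φ x` subject to `0 ∈ G x`, `x ∈ Θ`. -/
noncomputable def primalValue {E F : Type*} [Zero F] (φ : E → EReal) (Θ : Set E)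
    (G : E → Set F) : EReal :=
  ⨅ x ∈ {x : E | x ∈ Θ ∧ (0 : F) ∈ G x}, φ x

/-- The Lagrange–Fenchel dual objective
`h₁(u*, y*) = -φ*(u*) + inf {⟨u*, x⟩ + v_G(x, y*) | x ∈ Θ}`. -/
noncomputable def dualObjective {E F : Type*} [NormedAddCommGroup E] [InnerProductSpace ℝ E]
    [NormedAddCommGroup F] [InnerProductSpace ℝ F] (φ : E → EReal) (Θ : Set E)
    (G : E → Set F) (ustar : E) (ystar : F) : EReal :=
  -fenchelConj φ ustar + ⨅ x ∈ Θ, (((inner ℝ ustar x : ℝ) : EReal) + vG G x ystar)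

/-- The optimal value of the Lagrange–Fenchel dual problem. -/
noncomputable def dualValue {E F : Type*} [NormedAddCommGroup E] [InnerProductSpace ℝ E]
    [NormedAddCommGroup F] [InnerProductSpace ℝ F] (φ : E → EReal) (Θ : Set E)
    (G : E → Set F) : EReal :=
  ⨆ (ustar : E) (ystar : F), dualObjective φ Θ G ustar ystar

end NearConvexDuality

namespace NearConvexDuality

/-! ### Relative interiors of nearly convex sets. -/

section RelativeInterior

variable {E F : Type*} [NormedAddCommGroup E] [NormedSpace ℝ E]
  [NormedAddCommGroup F] [NormedSpace ℝ F]

/-! A nearly convex set has the relative interior of its convex core, so the line segment principle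
survives (`NearlyConvex.combo_mem_intrinsicInterior`) and convex arguments can be run on relative
interiors. The two qualification conditions merge into one feasible `x₀` that is relatively interior
to `dom φ` and `Θ`, with `(x₀, 0)` relatively interior to the graph of `G`
(`exists_feasible_mem_intrinsicInterior`).

Decouple the variables: collect `((x' - x, y), l)` with `(x, l)` in ri epi `φ`, `x'` in ri `Θ` and
`(x', y)` in ri gph `G`. This set is convex, lies above the finite primal value `p` over the origin,
and has the origin relatively interior to its projection thanks to `x₀`. A non-vertical supporting
hyperplane (`exists_linear_minorant`) then exists. Its slope extends from the relative interiors to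
the full data by a limit along segments, and is an optimal dual pair (`le_dualObjective`). Weak
duality gives the other inequality. -/

theorem mem_intrinsicInterior_iff_ball {s : Set E} {a : E} :
    a ∈ intrinsicInterior ℝ s ↔
      a ∈ affineSpan ℝ s ∧ ∃ δ > 0, ∀ y ∈ affineSpan ℝ s, dist y a < δ → y ∈ s := by
  rw [mem_intrinsicInterior]
  constructor
  · rintro ⟨⟨y, hy⟩, hi, rfl⟩
    refine ⟨hy, ?_⟩
    obtain ⟨δ, hδ, h⟩ := Metric.mem_nhds_iff.1 (mem_interior_iff_mem_nhds.1 hi)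
    exact ⟨δ, hδ, fun z hz hd => h (show (⟨z, hz⟩ : affineSpan ℝ s) ∈ _ from hd)⟩
  · rintro ⟨ha, δ, hδ, h⟩
    refine ⟨⟨a, ha⟩, mem_interior_iff_mem_nhds.2 (Metric.mem_nhds_iff.2 ⟨δ, hδ, ?_⟩), rfl⟩
    rintro ⟨z, hz⟩ hd
    exact h z hz hd

theorem affineSpan_eq_of_subset_closure [FiniteDimensional ℝ E] {C s : Set E} (h₁ : C ⊆ s)
    (h₂ : s ⊆ closure C) : affineSpan ℝ s = affineSpan ℝ C := by
  refine le_antisymm (affineSpan_le.2 (h₂.trans ?_)) (affineSpan_mono ℝ h₁)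
  exact closure_minimal (subset_affineSpan ℝ C) (AffineSubspace.closed_of_finiteDimensional _)

theorem smul_add_smul_mem_affineSpan {s : AffineSubspace ℝ E} {a b : E} (ha : a ∈ s) (hb : b ∈ s)
    (t : ℝ) : (1 - t) • a + t • b ∈ s := by
  have := AffineMap.lineMap_mem t ha hb
  rwa [AffineMap.lineMap_apply_module] at this

/-- The line segment principle for the relative interior of a convex set. -/
theorem _root_.Convex.combo_intrinsicInterior_closure_mem [FiniteDimensional ℝ E] {C : Set E}
    (hC : Convex ℝ C) {a b : E} (ha : a ∈ intrinsicInterior ℝ C) (hb : b ∈ closure C) {t : ℝ}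
    (ht₀ : 0 ≤ t) (ht₁ : t < 1) : (1 - t) • a + t • b ∈ intrinsicInterior ℝ C := by
  rw [mem_intrinsicInterior_iff_ball] at ha ⊢
  obtain ⟨ha, δ, hδ, h⟩ := ha
  have hbs : b ∈ affineSpan ℝ C :=
    closure_minimal (subset_affineSpan ℝ C) (AffineSubspace.closed_of_finiteDimensional _) hb
  have ht : 0 < 1 - t := by linarith
  refine ⟨smul_add_smul_mem_affineSpan ha hbs t, (1 - t) * δ / 2, by positivity, ?_⟩
  intro y hy hd
  obtain ⟨b', hb', hbb⟩ := Metric.mem_closure_iff.1 hb ((1 - t) * δ / 2) (by positivity)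
  -- `a'` solves `y = (1 - t) • a' + t • b'`. The errors from `y` and from `b'` each cost at most
  -- half of `(1 - t) * δ`, so `a'` stays within `δ` of `a`.
  set a' : E := (1 - (-t / (1 - t))) • y + (-t / (1 - t)) • b' with ha'
  have e₁ : (1 - t) • a' = y - t • b' := by
    rw [ha', smul_add, smul_smul, smul_smul]
    rw [show (1 - t) * (1 - -t / (1 - t)) = 1 by field_simp; ring,
      show (1 - t) * (-t / (1 - t)) = -t by field_simp]
    module
  have hmem : a' ∈ C := by
    refine h a' (smul_add_smul_mem_affineSpan hy (subset_affineSpan ℝ C hb') _) ?_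
    have e₂ : (1 - t) • (a' - a) = (y - ((1 - t) • a + t • b)) + t • (b - b') := by
      rw [smul_sub, e₁]; module
    have h₁ : (1 - t) * ‖a' - a‖ = ‖(y - ((1 - t) • a + t • b)) + t • (b - b')‖ := by
      rw [← e₂, norm_smul, Real.norm_of_nonneg ht.le]
    have h₂ := norm_add_le (y - ((1 - t) • a + t • b)) (t • (b - b'))
    rw [norm_smul, Real.norm_of_nonneg ht₀] at h₂
    rw [dist_eq_norm] at hd hbb ⊢
    have h₃ : t * ‖b - b'‖ ≤ ‖b - b'‖ := mul_le_of_le_one_left (norm_nonneg _) ht₁.le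
    have h₄ : (1 - t) * ‖a' - a‖ < (1 - t) * δ := by linarith
    exact lt_of_mul_lt_mul_left h₄ ht.le
  have : y = (1 - t) • a' + t • b' := by rw [e₁]; module
  rw [this]
  exact hC hmem hb' ht.le ht₀ (by ring)

/-- Points of the relative interior can be moved a little away from any point of the set. -/
theorem exists_pos_add_smul_sub_mem {s : Set E} {a b : E} (ha : a ∈ intrinsicInterior ℝ s)
    (hb : b ∈ s) : ∃ ε > (0 : ℝ), ∀ ε' : ℝ, 0 ≤ ε' → ε' ≤ ε → (1 + ε') • a - ε' • b ∈ s := by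
  obtain ⟨ha, δ, hδ, h⟩ := mem_intrinsicInterior_iff_ball.1 ha
  refine ⟨δ / (2 * (‖a - b‖ + 1)), by positivity, fun ε h₀ h₁ => h _ ?_ ?_⟩
  · have := smul_add_smul_mem_affineSpan ha (subset_affineSpan ℝ s hb) (-ε)
    convert this using 1; module
  · rw [dist_eq_norm, show (1 + ε) • a - ε • b - a = ε • (a - b) by module, norm_smul,
      Real.norm_of_nonneg h₀]
    have hn := norm_nonneg (a - b)
    rw [le_div_iff₀ (by positivity)] at h₁
    nlinarith

theorem NearlyConvex.image {s : Set E} (hs : NearlyConvex s) (f : E →L[ℝ] F) : NearlyConvex (f '' s) := by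
  obtain ⟨C, hC, h₁, h₂⟩ := hs
  refine ⟨f '' C, hC.linear_image f.toLinearMap, Set.image_mono h₁, ?_⟩
  exact (Set.image_mono h₂).trans (image_closure_subset_closure_image f.continuous)

variable [FiniteDimensional ℝ E]

theorem intrinsicInterior_subset_of_subset_closure {C s : Set E} (h₁ : C ⊆ s)
    (h₂ : s ⊆ closure C) : intrinsicInterior ℝ C ⊆ intrinsicInterior ℝ s := by
  intro a ha
  rw [mem_intrinsicInterior_iff_ball] at ha ⊢
  rw [affineSpan_eq_of_subset_closure h₁ h₂]
  obtain ⟨ha, δ, hδ, h⟩ := ha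
  exact ⟨ha, δ, hδ, fun y hy hd => h₁ (h y hy hd)⟩

/-- A nearly convex set has the same relative interior as the convex set it comes from. -/
theorem intrinsicInterior_eq_of_subset_closure {C s : Set E} (hC : Convex ℝ C) (h₁ : C ⊆ s)
    (h₂ : s ⊆ closure C) : intrinsicInterior ℝ s = intrinsicInterior ℝ C := by
  refine Set.Subset.antisymm (fun a ha => ?_) (intrinsicInterior_subset_of_subset_closure h₁ h₂)
  have hne : C.Nonempty := closure_nonempty_iff.1 ⟨a, h₂ (intrinsicInterior_subset ha)⟩
  obtain ⟨b, hb⟩ := hne.intrinsicInterior hC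
  obtain ⟨ε, hε, h⟩ := exists_pos_add_smul_sub_mem ha (h₁ (intrinsicInterior_subset hb))
  -- `a` lies on the segment from `b` to its prolongation beyond `a`, at parameter `1 / (1 + ε)`.
  have hc := hC.combo_intrinsicInterior_closure_mem hb (h₂ (h ε hε.le le_rfl))
    (t := 1 / (1 + ε)) (by positivity) (by rw [div_lt_one (by positivity)]; linarith)
  convert hc using 1
  rw [smul_sub, smul_smul, smul_smul, show 1 / (1 + ε) * (1 + ε) = 1 by field_simp,
    show 1 / (1 + ε) * ε = 1 - 1 / (1 + ε) by field_simp; ring]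
  module

namespace NearlyConvex

variable {s : Set E}

/-- The line segment principle for nearly convex sets. -/
theorem combo_mem_intrinsicInterior (hs : NearlyConvex s) {a b : E}
    (ha : a ∈ intrinsicInterior ℝ s) (hb : b ∈ s) {t : ℝ} (ht₀ : 0 ≤ t) (ht₁ : t < 1) :
    (1 - t) • a + t • b ∈ intrinsicInterior ℝ s := by
  obtain ⟨C, hC, h₁, h₂⟩ := hs
  rw [intrinsicInterior_eq_of_subset_closure hC h₁ h₂] at ha ⊢
  exact hC.combo_intrinsicInterior_closure_mem ha (h₂ hb) ht₀ ht₁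

theorem convex_intrinsicInterior (hs : NearlyConvex s) : Convex ℝ (intrinsicInterior ℝ s) := by
  intro a ha b hb c d hc hd hcd
  obtain rfl : c = 1 - d := by linarith
  rcases hc.eq_or_lt with h | h
  · obtain rfl : d = 1 := by linarith
    simpa using hb
  · exact hs.combo_mem_intrinsicInterior ha (intrinsicInterior_subset hb) hd (by linarith)

theorem nonempty_intrinsicInterior (hs : NearlyConvex s) (hne : s.Nonempty) :
    (intrinsicInterior ℝ s).Nonempty := by
  obtain ⟨C, hC, h₁, h₂⟩ := hs
  rw [intrinsicInterior_eq_of_subset_closure hC h₁ h₂]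
  exact (closure_nonempty_iff.1 (hne.mono h₂)).intrinsicInterior hC

/-- Prolonging a segment inside the relative interior. -/
theorem exists_prolong_mem_intrinsicInterior (hs : NearlyConvex s) {a b : E}
    (ha : a ∈ intrinsicInterior ℝ s) (hb : b ∈ s) :
    ∃ ε > (0 : ℝ), ∀ ε' : ℝ, 0 ≤ ε' → ε' ≤ ε → (1 + ε') • a - ε' • b ∈ intrinsicInterior ℝ s := by
  obtain ⟨ε, hε, h⟩ := exists_pos_add_smul_sub_mem ha hb
  -- Halving leaves room to take the midpoint of `a` and the point prolonged by `2 * ε'`.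
  refine ⟨ε / 2, by positivity, fun ε' h₀ h₁ => ?_⟩
  have := hs.combo_mem_intrinsicInterior ha (h (2 * ε') (by linarith) (by linarith))
    (t := 1 / 2) (by norm_num) (by norm_num)
  convert this using 1
  module

/-- Relative interior points of a linear image lift to relative interior points. -/
theorem exists_mem_intrinsicInterior_of_image (hs : NearlyConvex s) (f : E →ₗ[ℝ] F) {y : F}
    (hy : y ∈ intrinsicInterior ℝ (f '' s)) : ∃ x ∈ intrinsicInterior ℝ s, f x = y := by
  have hne : s.Nonempty := Set.image_nonempty.1 ⟨y, intrinsicInterior_subset hy⟩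
  obtain ⟨x₀, hx₀⟩ := hs.nonempty_intrinsicInterior hne
  -- Prolong from `f x₀` through `y` inside the image, lift the endpoint to `x₁`, and return along
  -- the segment from `x₀` to `x₁`.
  obtain ⟨ε, hε, h⟩ :=
    exists_pos_add_smul_sub_mem hy (Set.mem_image_of_mem f (intrinsicInterior_subset hx₀))
  obtain ⟨x₁, hx₁, he⟩ := h ε hε.le le_rfl
  refine ⟨_, hs.combo_mem_intrinsicInterior hx₀ hx₁ (t := 1 / (1 + ε)) (by positivity)
    (by rw [div_lt_one (by positivity)]; linarith), ?_⟩
  rw [map_add, map_smul, map_smul, he, smul_sub, smul_smul, smul_smul,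
    show 1 / (1 + ε) * (1 + ε) = 1 by field_simp,
    show 1 / (1 + ε) * ε = 1 - 1 / (1 + ε) by field_simp; ring]
  module

end NearlyConvex

end RelativeInterior

/-! ### Non-vertical supporting hyperplanes. -/

section Subgradient

variable {V : Type*} [AddCommGroup V] [Module ℝ V]

/-- The cone generated by a convex set is closed under addition; the scaled negatives make it closed
under negation too, hence a subspace. -/
theorem exists_nonneg_smul_of_mem_span {T : Set V} (hT : Convex ℝ T) (hne : T.Nonempty)
    (hneg : ∀ v ∈ T, ∃ ε > (0 : ℝ), -(ε • v) ∈ T) {v : V} (hv : v ∈ Submodule.span ℝ T) :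
    ∃ c : ℝ, 0 ≤ c ∧ ∃ w ∈ T, v = c • w := by
  induction hv using Submodule.span_induction with
  | mem x hx => exact ⟨1, zero_le_one, x, hx, (one_smul _ _).symm⟩
  | zero => exact ⟨0, le_rfl, hne.some, hne.some_mem, (zero_smul _ _).symm⟩
  | add x y _ _ hx hy =>
    obtain ⟨c, hc, w, hw, rfl⟩ := hx
    obtain ⟨d, hd, z, hz, rfl⟩ := hy
    rcases (add_nonneg hc hd).eq_or_lt with h | h
    · obtain rfl : c = 0 := by linarith
      obtain rfl : d = 0 := by linarith
      exact ⟨0, le_rfl, w, hw, by simp⟩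
    · refine ⟨c + d, h.le, _, hT hw hz (a := c / (c + d)) (b := d / (c + d)) (by positivity)
        (by positivity) (by field_simp), ?_⟩
      rw [smul_add, smul_smul, smul_smul, mul_div_cancel₀ _ h.ne', mul_div_cancel₀ _ h.ne']
  | smul a x _ hx =>
    obtain ⟨c, hc, w, hw, rfl⟩ := hx
    rcases le_total 0 a with ha | ha
    · exact ⟨a * c, mul_nonneg ha hc, w, hw, smul_smul _ _ _⟩
    · obtain ⟨ε, hε, hw'⟩ := hneg w hw
      refine ⟨-a * c / ε, div_nonneg (mul_nonneg (neg_nonneg.2 ha) hc) hε.le, _, hw', ?_⟩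
      rw [smul_neg, smul_smul (_ / ε), div_mul_cancel₀ _ hε.ne']
      module

/-- A convex set of `V × ℝ` whose projection to `V` has the origin as an algebraic relative
interior point, and which lies above level `p` over the origin, lies above a non-vertical
hyperplane through `(0, p)`. -/
theorem exists_linear_minorant {K : Set (V × ℝ)} (hK : Convex ℝ K) (hne : K.Nonempty)
    (hneg : ∀ v ∈ K, ∃ ε > (0 : ℝ), ∃ μ : ℝ, (-(ε • v.1), μ) ∈ K) {p : ℝ}
    (hp : ∀ l : ℝ, ((0 : V), l) ∈ K → p ≤ l) :
    ∃ f : V →ₗ[ℝ] ℝ, ∀ v ∈ K, p ≤ v.2 + f v.1 := by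
  set T : Set V := Prod.fst '' K with hT
  have hTc : Convex ℝ T := hK.linear_image (LinearMap.fst ℝ V ℝ)
  have hTneg : ∀ v ∈ T, ∃ ε > (0 : ℝ), -(ε • v) ∈ T := by
    rintro _ ⟨v, hv, rfl⟩
    obtain ⟨ε, hε, μ, h⟩ := hneg v hv
    exact ⟨ε, hε, _, h, rfl⟩
  -- Pulling the cone back along a projection onto `span T` lets `riesz_extension` run on all of `V
  -- × ℝ`, although `T` need not span `V`.
  obtain ⟨P, hP⟩ := (Submodule.span ℝ T).subtype.exists_leftInverse_of_injective
    (Submodule.ker_subtype _)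
  have hPT : ∀ v ∈ T, (P v : V) = v := fun v hv => by
    have := LinearMap.congr_fun hP ⟨v, Submodule.subset_span hv⟩
    simpa using congrArg Subtype.val this
  let s : PointedCone ℝ (V × ℝ) :=
    { carrier := {z | ∃ c : ℝ, 0 ≤ c ∧ ∃ v ∈ K, (P z.1 : V) = c • v.1 ∧ c * (v.2 - p) ≤ z.2}
      zero_mem' := ⟨0, le_rfl, hne.some, hne.some_mem, by simp, by simp⟩
      add_mem' := by
        rintro y z ⟨c, hc, v, hv, h₁, h₂⟩ ⟨d, hd, w, hw, h₃, h₄⟩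
        rcases (add_nonneg hc hd).eq_or_lt with h | h
        · obtain rfl : c = 0 := by linarith
          obtain rfl : d = 0 := by linarith
          refine ⟨0, le_rfl, v, hv, by simp [h₁, h₃], ?_⟩
          simp only [Prod.snd_add]; linarith
        · refine ⟨c + d, h.le, _, hK hv hw (a := c / (c + d)) (b := d / (c + d)) (by positivity)
            (by positivity) (by field_simp), ?_, ?_⟩
          · simp only [Prod.fst_add, map_add, Submodule.coe_add, h₁, h₃, Prod.smul_fst, smul_add,
              smul_smul, mul_div_cancel₀ _ h.ne']
          · simp only [Prod.snd_add, Prod.smul_snd, smul_eq_mul]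
            have : (c + d) * (c / (c + d) * v.2 + d / (c + d) * w.2 - p)
                = c * (v.2 - p) + d * (w.2 - p) := by field_simp; ring
            linarith
      smul_mem' := by
        rintro ⟨a, ha⟩ z ⟨c, hc, v, hv, h₁, h₂⟩
        refine ⟨a * c, mul_nonneg ha hc, v, hv, ?_, ?_⟩
        · change ((P (a • z.1) : Submodule.span ℝ T) : V) = _
          rw [map_smul, Submodule.coe_smul, h₁, smul_smul]
        · change _ ≤ a * z.2
          rw [mul_assoc]
          exact mul_le_mul_of_nonneg_left h₂ ha }
  have hs : ∀ z, z ∈ s ↔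
      ∃ c : ℝ, 0 ≤ c ∧ ∃ v ∈ K, (P z.1 : V) = c • v.1 ∧ c * (v.2 - p) ≤ z.2 := fun _ => Iff.rfl
  -- The functional to extend is the height on the vertical axis; prescribing it there keeps the
  -- hyperplane non-vertical.
  let D : Submodule ℝ (V × ℝ) := LinearMap.ker (LinearMap.fst ℝ V ℝ)
  let f : (V × ℝ) →ₗ.[ℝ] ℝ := ⟨D, (LinearMap.snd ℝ V ℝ).comp D.subtype⟩
  have hnn : ∀ x : f.domain, (x : V × ℝ) ∈ s → 0 ≤ f x := by
    rintro ⟨⟨v, t⟩, hx⟩ hmem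
    obtain rfl : v = 0 := hx
    change 0 ≤ t
    obtain ⟨c, hc, w, hw, h₁, h₂⟩ := (hs _).1 hmem
    rcases hc.eq_or_lt with rfl | hc
    · simpa using h₂
    · have hw0 : w.1 = 0 := by
        simpa [hc.ne'] using h₁.symm
      have : p ≤ w.2 := hp w.2 (by rw [← hw0]; exact hw)
      exact (mul_nonneg hc.le (sub_nonneg.2 this)).trans h₂
  have hdense : ∀ y, ∃ x : f.domain, (x : V × ℝ) + y ∈ s := by
    rintro ⟨v, μ⟩
    obtain ⟨c, hc, w, ⟨w, hw, rfl⟩, he⟩ :=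
      exists_nonneg_smul_of_mem_span hTc (hne.image _) hTneg (P v).2
    refine ⟨⟨(0, c * (w.2 - p) - μ), rfl⟩, (hs _).2 ⟨c, hc, w, hw, ?_, ?_⟩⟩
    · simpa using he
    · simp
  obtain ⟨g, hg, hgs⟩ := riesz_extension s f hnn hdense
  refine ⟨g.comp (LinearMap.inl ℝ V ℝ), fun v hv => ?_⟩
  have h₁ : 0 ≤ g (v.1, v.2 - p) :=
    hgs _ ((hs _).2 ⟨1, zero_le_one, v, hv, by
      rw [one_smul]; exact hPT _ ⟨v, hv, rfl⟩, by simp⟩)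
  have h₂ : g (0, v.2 - p) = v.2 - p := hg ⟨(0, v.2 - p), rfl⟩
  have h₃ : g (v.1, v.2 - p) = g (v.1, 0) + g (0, v.2 - p) := by
    rw [← map_add]; simp
  simp only [LinearMap.comp_apply, LinearMap.inl_apply]
  linarith

end Subgradient

/-! ### Multipliers and Lagrange–Fenchel duality. -/

section Duality

theorem fst_image_epi {E : Type*} (φ : E → EReal) : Prod.fst '' epi φ = effDom φ := by
  ext x
  constructor
  · rintro ⟨⟨x, l⟩, h, rfl⟩
    exact lt_of_le_of_lt h (EReal.coe_lt_top l)
  · intro h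
    exact ⟨(x, (φ x).toReal), EReal.le_coe_toReal h.ne, rfl⟩

theorem fst_image_svGraph {E F : Type*} (G : E → Set F) : Prod.fst '' svGraph G = svDom G := by
  ext x
  constructor
  · rintro ⟨⟨x, y⟩, h, rfl⟩
    exact ⟨y, h⟩
  · rintro ⟨y, h⟩
    exact ⟨(x, y), h, rfl⟩

section Normed

variable {E F : Type*} [NormedAddCommGroup E] [NormedSpace ℝ E] [FiniteDimensional ℝ E]
  [NormedAddCommGroup F] [NormedSpace ℝ F] [FiniteDimensional ℝ F]
  {φ : E → EReal} {Θ : Set E} {G : E → Set F}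

/-- The qualification conditions provide a feasible point in the relative interior of all the
data of the problem. -/
theorem exists_feasible_mem_intrinsicInterior (hφ : NearlyConvexFun φ) (hΘ : NearlyConvex Θ)
    (hG : NearlyConvexMap G)
    (hri : (intrinsicInterior ℝ (effDom φ) ∩ intrinsicInterior ℝ (svDom G) ∩
      intrinsicInterior ℝ Θ).Nonempty)
    (hzero : (0 : F) ∈ intrinsicInterior ℝ (svImage G (Θ ∩ effDom φ))) :
    ∃ x ∈ intrinsicInterior ℝ (effDom φ), x ∈ intrinsicInterior ℝ Θ ∧
      (x, (0 : F)) ∈ intrinsicInterior ℝ (svGraph G) := by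
  obtain ⟨x₁, ⟨h₁, h₂⟩, h₃⟩ := hri
  have hdom : NearlyConvex (effDom φ) := by
    rw [← fst_image_epi]
    exact NearlyConvex.image hφ (ContinuousLinearMap.fst ℝ E ℝ)
  rw [← fst_image_svGraph] at h₂
  obtain ⟨⟨x, y₁⟩, hxy, rfl⟩ :=
    NearlyConvex.exists_mem_intrinsicInterior_of_image hG (LinearMap.fst ℝ E F) h₂
  change x ∈ _ at h₁ h₃
  have hy₁ : y₁ ∈ svImage G (Θ ∩ effDom φ) :=
    Set.mem_biUnion (⟨intrinsicInterior_subset h₃, intrinsicInterior_subset h₁⟩ : x ∈ Θ ∩ effDom φ)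
      (intrinsicInterior_subset hxy : (x, y₁) ∈ svGraph G)
  -- The value `-ε • y₁` is attained at some `x₂` in `Θ ∩ dom φ`; weight `1 / (1 + ε)` on it cancels
  -- `y₁`.
  obtain ⟨ε, hε, h⟩ := exists_pos_add_smul_sub_mem hzero hy₁
  obtain ⟨x₂, ⟨hx₂Θ, hx₂φ⟩, hx₂⟩ := Set.mem_iUnion₂.1 (h ε hε.le le_rfl)
  have ht₀ : 0 ≤ 1 / (1 + ε) := by positivity
  have ht₁ : 1 / (1 + ε) < 1 := by rw [div_lt_one (by positivity)]; linarith
  refine ⟨_, hdom.combo_mem_intrinsicInterior h₁ hx₂φ ht₀ ht₁,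
    hΘ.combo_mem_intrinsicInterior h₃ hx₂Θ ht₀ ht₁, ?_⟩
  have hc := NearlyConvex.combo_mem_intrinsicInterior hG hxy
    (show (x₂, (1 + ε) • (0 : F) - ε • y₁) ∈ svGraph G from hx₂) ht₀ ht₁
  convert hc using 1
  ext1
  · simp
  · simp only [Prod.snd_add, Prod.smul_snd, smul_zero, zero_sub, smul_neg, smul_smul]
    rw [show 1 / (1 + ε) * ε = 1 - 1 / (1 + ε) by field_simp; ring]
    module

/-- A Lagrange multiplier for the problem, in the form of a linear functional. -/
theorem exists_linear_multiplier (hφ : NearlyConvexFun φ) (hΘ : NearlyConvex Θ)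
    (hG : NearlyConvexMap G) {x₀ : E} (h₁ : x₀ ∈ intrinsicInterior ℝ (effDom φ))
    (h₂ : x₀ ∈ intrinsicInterior ℝ Θ) (h₃ : (x₀, (0 : F)) ∈ intrinsicInterior ℝ (svGraph G))
    {p : ℝ} (hp : ∀ x ∈ Θ, (0 : F) ∈ G x → (p : EReal) ≤ φ x) :
    ∃ f : E × F →ₗ[ℝ] ℝ, ∀ (x : E) (l : ℝ), φ x ≤ l → ∀ x' ∈ Θ, ∀ y ∈ G x',
      p ≤ l + f (x' - x, y) := by
  rw [← fst_image_epi] at h₁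
  obtain ⟨⟨x₀, l₀⟩, h₀, rfl⟩ :=
    NearlyConvex.exists_mem_intrinsicInterior_of_image hφ (LinearMap.fst ℝ E ℝ) h₁
  change x₀ ∈ _ at h₂
  change (x₀, (0 : F)) ∈ _ at h₃
  set K : Set ((E × F) × ℝ) := {v | ∃ x x' : E, (x, v.2) ∈ intrinsicInterior ℝ (epi φ) ∧
    x' ∈ intrinsicInterior ℝ Θ ∧ (x', v.1.2) ∈ intrinsicInterior ℝ (svGraph G) ∧
    v.1.1 = x' - x} with hKdef
  have hK : Convex ℝ K := by
    rintro v ⟨x, x', a₁, a₂, a₃, a₄⟩ w ⟨z, z', b₁, b₂, b₃, b₄⟩ c d hc hd hcd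
    refine ⟨c • x + d • z, c • x' + d • z',
      NearlyConvex.convex_intrinsicInterior hφ a₁ b₁ hc hd hcd,
      hΘ.convex_intrinsicInterior a₂ b₂ hc hd hcd,
      NearlyConvex.convex_intrinsicInterior hG a₃ b₃ hc hd hcd, ?_⟩
    simp only [Prod.fst_add, Prod.smul_fst, a₄, b₄]
    module
  have hK₀ : ((0, 0), l₀) ∈ K := ⟨x₀, x₀, h₀, h₂, h₃, (sub_self _).symm⟩
  obtain ⟨f, hf⟩ := exists_linear_minorant (p := p) hK ⟨_, hK₀⟩ (by
    rintro ⟨⟨z, y⟩, l⟩ ⟨x, x', a₁, a₂, a₃, a₄⟩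
    obtain ⟨ε₁, hε₁, e₁⟩ := NearlyConvex.exists_prolong_mem_intrinsicInterior hφ h₀
      (intrinsicInterior_subset a₁)
    obtain ⟨ε₂, hε₂, e₂⟩ := hΘ.exists_prolong_mem_intrinsicInterior h₂
      (intrinsicInterior_subset a₂)
    obtain ⟨ε₃, hε₃, e₃⟩ := NearlyConvex.exists_prolong_mem_intrinsicInterior hG h₃
      (intrinsicInterior_subset a₃)
    have hε : 0 < min ε₁ (min ε₂ ε₃) := by positivity
    set ε := min ε₁ (min ε₂ ε₃) with hεdef
    refine ⟨ε, hε, (1 + ε) * l₀ - ε * l, (1 + ε) • x₀ - ε • x, (1 + ε) • x₀ - ε • x',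
      e₁ ε hε.le (min_le_left _ _),
      e₂ ε hε.le ((min_le_right _ _).trans (min_le_left _ _)), ?_, ?_⟩
    · have := e₃ ε hε.le ((min_le_right _ _).trans (min_le_right _ _))
      simpa using this
    · change z = x' - x at a₄
      change -(ε • z) = _
      rw [a₄]
      module) (by
    rintro l ⟨x, x', a₁, a₂, a₃, a₄⟩
    obtain rfl : x' = x := sub_eq_zero.1 a₄.symm
    have := (hp x' (intrinsicInterior_subset a₂)
      (intrinsicInterior_subset a₃ : (x', (0 : F)) ∈ svGraph G)).trans
      (intrinsicInterior_subset a₁ : (x', l) ∈ epi φ)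
    exact EReal.coe_le_coe_iff.1 this)
  refine ⟨f, fun x l hl x' hx' y hy => ?_⟩
  -- Arbitrary data points enter `K` after being pulled towards `x₀`; then `t → 1`.
  have hseg : ∀ t : ℝ, t ∈ Set.Ico (0 : ℝ) 1 → p ≤ (1 - t) * l₀ + t * (l + f (x' - x, y)) := by
    rintro t ⟨ht₀, ht₁⟩
    have b₁ := NearlyConvex.combo_mem_intrinsicInterior hφ h₀ (show (x, l) ∈ epi φ from hl) ht₀ ht₁
    have b₂ := hΘ.combo_mem_intrinsicInterior h₂ hx' ht₀ ht₁
    have b₃ := NearlyConvex.combo_mem_intrinsicInterior hG h₃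
      (show (x', y) ∈ svGraph G from hy) ht₀ ht₁
    have hmem : (t • (x' - x, y), (1 - t) * l₀ + t * l) ∈ K := by
      refine ⟨_, _, b₁, b₂, ?_, ?_⟩
      · simpa using b₃
      · change t • (x' - x) = ((1 - t) • x₀ + t • x') - ((1 - t) • x₀ + t • x)
        module
    have := hf _ hmem
    simp only [map_smul, smul_eq_mul] at this
    linarith
  have hlim : Filter.Tendsto (fun t : ℝ => (1 - t) * l₀ + t * (l + f (x' - x, y)))
      (nhdsWithin 1 (Set.Iio 1)) (nhds ((1 - 1) * l₀ + 1 * (l + f (x' - x, y)))) :=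
    (Continuous.tendsto (by fun_prop) 1).mono_left nhdsWithin_le_nhds
  have := ge_of_tendsto hlim (Filter.eventually_of_mem (Ico_mem_nhdsLT zero_lt_one) hseg)
  simpa using this

end Normed

variable {E F : Type*} [NormedAddCommGroup E] [InnerProductSpace ℝ E]
  [NormedAddCommGroup F] [InnerProductSpace ℝ F]
  {φ : E → EReal} {Θ : Set E} {G : E → Set F}

/-- At a feasible `x`, Fenchel's inequality bounds the conjugate term, and `0 ∈ G x` makes `vG G x
y` nonpositive. -/
theorem dualValue_le_primalValue : dualValue φ Θ G ≤ primalValue φ Θ G := by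
  refine iSup₂_le fun u y => le_iInf₂ fun x hx => ?_
  have h₁ : -fenchelConj φ u ≤ -(((inner ℝ u x : ℝ) : EReal) - φ x) :=
    EReal.neg_le_neg_iff.2 (le_iSup (fun x => ((inner ℝ u x : ℝ) : EReal) - φ x) x)
  have h₂ : (⨅ x ∈ Θ, (((inner ℝ u x : ℝ) : EReal) + vG G x y)) ≤ ((inner ℝ u x : ℝ) : EReal) := by
    refine (iInf₂_le x hx.1).trans ?_
    have h₃ : vG G x y ≤ 0 := (iInf₂_le 0 hx.2).trans (by simp)
    simpa using add_le_add_right h₃ ((inner ℝ u x : ℝ) : EReal)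
  refine (add_le_add h₁ h₂).trans ?_
  induction φ x with
  | bot => simp
  | top => simp
  | coe r => norm_cast; linarith

/-- Taking the supremum over `x` and the infimum over `(x', z)` separates the inequality. Properness
and `hne` make the conjugate finite, so the rearrangement happens in `ℝ`. -/
theorem le_dualObjective (hφ : ProperFun φ) {p : ℝ} {u : E} {y : F}
    (hne : ∃ x ∈ Θ, (G x).Nonempty)
    (h : ∀ (x : E) (l : ℝ), φ x ≤ l → ∀ x' ∈ Θ, ∀ z ∈ G x',
      p ≤ l + (inner ℝ u (x' - x) + inner ℝ (-y) z)) :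
    (p : EReal) ≤ dualObjective φ Θ G u y := by
  have hle : ∀ x' ∈ Θ, ∀ z ∈ G x',
      fenchelConj φ u ≤ ((inner ℝ u x' + inner ℝ (-y) z - p : ℝ) : EReal) := by
    intro x' hx' z hz
    refine iSup_le fun x => ?_
    have hx := hφ.2 x
    have hφx := h x
    revert hx hφx
    induction φ x with
    | bot => intro hx; exact absurd hx (lt_irrefl _)
    | top => intro _ _; simp
    | coe r =>
      intro _ hφx
      have := hφx r le_rfl x' hx' z hz
      rw [inner_sub_right] at this
      norm_cast
      linarith
  obtain ⟨x₀, hx₀, z₀, hz₀⟩ := hne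
  have htop : fenchelConj φ u ≠ ⊤ :=
    ne_top_of_le_ne_top (EReal.coe_ne_top _) (hle x₀ hx₀ z₀ hz₀)
  have hbot : fenchelConj φ u ≠ ⊥ := by
    obtain ⟨x, hx⟩ := hφ.1
    have hb := hφ.2 x
    refine ne_bot_of_le_ne_bot ?_ (le_iSup (fun x => ((inner ℝ u x : ℝ) : EReal) - φ x) x)
    change φ x < ⊤ at hx
    revert hx hb
    induction φ x with
    | bot => intro hb _; exact absurd hb (lt_irrefl _)
    | top => intro _ hx; exact absurd hx (lt_irrefl _)
    | coe r => intro _ _; exact EReal.coe_ne_bot _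
  unfold dualObjective
  lift fenchelConj φ u to ℝ using ⟨htop, hbot⟩ with s
  have hinf : ((s + p : ℝ) : EReal) ≤ ⨅ x ∈ Θ, (((inner ℝ u x : ℝ) : EReal) + vG G x y) := by
    refine le_iInf₂ fun x hx => ?_
    have hv : ((s + p - inner ℝ u x : ℝ) : EReal) ≤ vG G x y := by
      refine le_iInf₂ fun z hz => ?_
      have := EReal.coe_le_coe_iff.1 (hle x hx z hz)
      exact EReal.coe_le_coe_iff.2 (by linarith)
    refine le_trans (le_of_eq ?_) (add_le_add_right hv _)
    norm_cast
    ring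
  refine le_trans (le_of_eq ?_) (add_le_add_right hinf _)
  norm_cast
  ring

variable [FiniteDimensional ℝ E] [FiniteDimensional ℝ F]

theorem exists_inner_eq (f : E × F →ₗ[ℝ] ℝ) :
    ∃ (u : E) (y : F), ∀ x z, f (x, z) = inner ℝ u x + inner ℝ (-y) z := by
  refine ⟨(InnerProductSpace.toDual ℝ E).symm
      (LinearMap.toContinuousLinearMap (f.comp (LinearMap.inl ℝ E F))),
    -(InnerProductSpace.toDual ℝ F).symm
      (LinearMap.toContinuousLinearMap (f.comp (LinearMap.inr ℝ E F))), fun x z => ?_⟩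
  rw [neg_neg, InnerProductSpace.toDual_symm_apply, InnerProductSpace.toDual_symm_apply]
  simp only [LinearMap.coe_toContinuousLinearMap', LinearMap.comp_apply, LinearMap.inl_apply,
    LinearMap.inr_apply]
  rw [← map_add]
  simp

/-- Lagrange–Fenchel strong duality for nearly convex data in finite-dimensional spaces. -/
theorem primalValue_eq_dualValue (hφ_proper : ProperFun φ) (hφ : NearlyConvexFun φ)
    (hΘ : NearlyConvex Θ) (hG : NearlyConvexMap G)
    (hri : (intrinsicInterior ℝ (effDom φ) ∩ intrinsicInterior ℝ (svDom G) ∩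
      intrinsicInterior ℝ Θ).Nonempty)
    (hzero : (0 : F) ∈ intrinsicInterior ℝ (svImage G (Θ ∩ effDom φ))) :
    primalValue φ Θ G = dualValue φ Θ G := by
  refine le_antisymm ?_ dualValue_le_primalValue
  obtain ⟨x₀, h₁, h₂, h₃⟩ := exists_feasible_mem_intrinsicInterior hφ hΘ hG hri hzero
  have hle : ∀ x ∈ Θ, (0 : F) ∈ G x → primalValue φ Θ G ≤ φ x := fun x hx h0 =>
    iInf₂_le (f := fun x (_ : x ∈ {x : E | x ∈ Θ ∧ (0 : F) ∈ G x}) => φ x) x ⟨hx, h0⟩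
  have hx₀ := intrinsicInterior_subset h₂
  have h0 : (0 : F) ∈ G x₀ := (intrinsicInterior_subset h₃ : (x₀, (0 : F)) ∈ svGraph G)
  have htop : primalValue φ Θ G ≠ ⊤ :=
    ((hle x₀ hx₀ h0).trans_lt (intrinsicInterior_subset h₁ : x₀ ∈ effDom φ)).ne
  rcases eq_or_ne (primalValue φ Θ G) ⊥ with hbot | hbot
  -- An unbounded primal needs no multiplier.
  · rw [hbot]; exact bot_le
  lift primalValue φ Θ G to ℝ using ⟨htop, hbot⟩ with p
  obtain ⟨f, hf⟩ := exists_linear_multiplier hφ hΘ hG h₁ h₂ h₃ hle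
  obtain ⟨u, y, huy⟩ := exists_inner_eq f
  refine le_trans (le_dualObjective hφ_proper ⟨x₀, hx₀, 0, h0⟩ ?_)
    (le_iSup₂ (f := fun u y => dualObjective φ Θ G u y) u y)
  intro x l hl x' hx' z hz
  rw [← huy]
  exact hf x l hl x' hx' z hz

end Duality

end NearConvexDuality

theorem theorem7p6 {n q : ℕ}
    (φ : EuclideanSpace ℝ (Fin n) → EReal)
    (Θ : Set (EuclideanSpace ℝ (Fin n)))
    (G : EuclideanSpace ℝ (Fin n) → Set (EuclideanSpace ℝ (Fin q)))
    (hφ_proper : NearConvexDuality.ProperFun φ)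
    (hφ : NearConvexDuality.NearlyConvexFun φ)
    (hΘ : NearConvexDuality.NearlyConvex Θ)
    (hG : NearConvexDuality.NearlyConvexMap G)
    (hri : (intrinsicInterior ℝ (NearConvexDuality.effDom φ) ∩
      intrinsicInterior ℝ (NearConvexDuality.svDom G) ∩ intrinsicInterior ℝ Θ).Nonempty)
    (hzero : (0 : EuclideanSpace ℝ (Fin q)) ∈
      intrinsicInterior ℝ
        (NearConvexDuality.svImage G (Θ ∩ NearConvexDuality.effDom φ))) :
    NearConvexDuality.primalValue φ Θ G = NearConvexDuality.dualValue φ Θ G := by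
  exact NearConvexDuality.primalValue_eq_dualValue hφ_proper hφ hΘ hG hri hzero
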